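/- **Setting.** Let $\mathcal D_x\subset\mathbb R^{d_x}$, let $Z$ be a random vector in $\mathbb R^{d_z}$, and let $\mathcal D_z$ be the support of $Z$. Write $D=\mathcal D_x\times\mathcal D_z$. For $\alpha\in(0,1)$ and a function $h$ on $D$ let $V_\alpha(h(x,Z))=\inf\{\omega\in\mathbb R: P(h(x,Z)\le\omega)\ge\alpha\}$. Let $k$ be a continuous positive semidefinite kernel on $D$ with $k(p,p)\le 1$ for all $p\in D$ (for example a squared exponential kernel with unit signal variance), and let $f$ belong to its reproducing kernel Hilbert space, with $\|f\|_k\le B$. Assume that $x\mapsto V_\alpha(f(x,Z))$ has a maximizer $x_*\in\mathcal D_x$, and let $r(x)=V_\alpha(f(x_*,Z))-V_\alpha(f(x,Z))$ be the instantaneous regret. **Observations.** Let $\sigma_n>0$. At iterations $t=1,2,\dots$ a point $(x_t,z_t)\in D$ is queried and $y_t=f(x_t,z_t)+\epsilon_t$ is observed. There is a filtration $(\mathcal F_t)_{t\ge0}$ such that $(x_t,z_t)$ is $\mathcal F_{t-1}$-measurable, $\epsilon_t$ is $\mathcal F_t$-measurable and independent of $\mathcal F_{t-1}$, and $\epsilon_t\sim\mathcal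 N(0,\sigma_n^2)$ (so the noise is i.i.d. and the queries depend only on the past). For $t\ge 0$ let $K_t=(k(q_i,q_j))_{i,j\le t}$, $k_t(p)=(k(p,q_i))_{i\le t}$ with $q_i=(x_i,z_i)$, and $$\mu_t(p)=k_t(p)^\top(K_t+\sigma_n^2I)^{-1}(y_1,\dots,y_t)^\top,\qquad \sigma_t^2(p)=k(p,p)-k_t(p)^\top(K_t+\sigma_n^2I)^{-1}k_t(p).$$ Let $\gamma_T=\sup_{p_1,\dots,p_T\in D}\tfrac12\log\det\bigl(I+\sigma_n^{-2}(k(p_i,p_j))_{i,j\le T}\bigr)$ be the maximum information gain from $T$ observations, let $C_1=8/\log(1+\sigma_n^{-2})$, let $\delta\in(0,1)$ and, for $t\ge1$, $$\beta_t=\Bigl(B+\max(1,\sigma_n)\sqrt{2(\gamma_{t-1}+1+\log(1/\delta))}\Bigr)^2,\quad l_{t-1}=\mu_{t-1}-\beta_t^{1/2}\sigma_{t-1},\quad u_{t-1}=\mu_{t-1}+\beta_t^{1/2}\sigma_{t-1}.$$ **Algorithm.** Suppose that, for every $t\ge1$, $x_t$ maximizes $x\mapsto V_\alpha(u_{t-1}(x,Z))$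 over $\mathcal D_x$, and that $z_t\in\mathcal D_z$ is a lacing value with respect to $x_t$: $l_{t-1}(x_t,z_t)\le V_\alpha(l_{t-1}(x_t,Z))\le V_\alpha(u_{t-1}(x_t,Z))\le u_{t-1}(x_t,z_t)$. **Result.** With probability at least $1-\delta$, the following holds for all $T\ge1$ simultaneously: for every $t_*(T)\in\{1,\dots,T\}$ that maximizes $V_\alpha(l_{t-1}(x_t,Z))$ over $t\in\{1,\dots,T\}$, the recommended input $x_{t_*(T)}$ satisfies $$r(x_{t_*(T)})\le\sqrt{C_1\beta_T\gamma_T/T}.$$ -/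

import Mathlib

open MeasureTheory ProbabilityTheory

namespace VUCB

noncomputable section

/-- Value-at-risk at level `α` of the random variable `h(Z)`, where `P` is the law of `Z`:
`inf {w : P(h(Z) ≤ w) ≥ α}`. -/
def valueAtRisk {E : Type*} [MeasurableSpace E] (P : Measure E) (α : ℝ) (h : E → ℝ) : ℝ :=
  sInf {w : ℝ | α ≤ P.real {e | h e ≤ w}}

/-- The kernel matrix `K_{D_t D_t}` of the inputs `q`. -/
def gram {D : Type*} (k : D → D → ℝ) {t : ℕ} (q : Fin t → D) : Matrix (Fin t) (Fin t) ℝ :=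
  Matrix.of fun i j => k (q i) (q j)

/-- The vector `K_{p, D_t}`. -/
def crossCov {D : Type*} (k : D → D → ℝ) {t : ℕ} (q : Fin t → D) (p : D) : Fin t → ℝ :=
  fun i => k p (q i)

/-- The matrix `Λ = (K + σ² I)⁻¹`. -/
def precision {D : Type*} (k : D → D → ℝ) (σ : ℝ) {t : ℕ} (q : Fin t → D) :
    Matrix (Fin t) (Fin t) ℝ :=
  (gram k q + σ ^ 2 • (1 : Matrix (Fin t) (Fin t) ℝ))⁻¹

/-- Posterior mean at `p` of the centred Gaussian process with covariance `k`, given noisy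
observations `y` at the inputs `q`. -/
def postMean {D : Type*} (k : D → D → ℝ) (σ : ℝ) {t : ℕ} (q : Fin t → D) (y : Fin t → ℝ)
    (p : D) : ℝ :=
  crossCov k q p ⬝ᵥ (precision k σ q).mulVec y

/-- Posterior variance at `p`. -/
def postVar {D : Type*} (k : D → D → ℝ) (σ : ℝ) {t : ℕ} (q : Fin t → D) (p : D) : ℝ :=
  k p p - crossCov k q p ⬝ᵥ (precision k σ q).mulVec (crossCov k q p)

/-- Posterior standard deviation at `p`. -/
def postStd {D : Type*} (k : D → D → ℝ) (σ : ℝ) {t : ℕ} (q : Fin t → D) (p : D) : ℝ :=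
  √(postVar k σ q p)

/-- Information gain (mutual information, in nats, between the noisy observations at `q` and the
values of the Gaussian process at `q`): `½ log det (I + σ⁻² K)`. -/
def infoGain {D : Type*} (k : D → D → ℝ) (σ : ℝ) {T : ℕ} (q : Fin T → D) : ℝ :=
  1 / 2 * Real.log (1 + (σ ^ 2)⁻¹ • gram k q).det

/-- Maximum information gain `γ_T` over all choices of `T` inputs (repetitions allowed). -/
def maxInfoGain {D : Type*} (k : D → D → ℝ) (σ : ℝ) (T : ℕ) : ℝ :=
  ⨆ q : Fin T → D, infoGain k σ q

/-- The confidence parameter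
`β_t = (B + max(1, σ) √(2 (γ_{t-1} + 1 + log (1 / δ))))²`, for `t ≥ 1`. -/
def beta {D : Type*} (k : D → D → ℝ) (σ B δ : ℝ) (t : ℕ) : ℝ :=
  (B + max 1 σ * √(2 * (maxInfoGain k σ (t - 1) + 1 + Real.log (1 / δ)))) ^ 2

/-- The restriction of a sequence (indexed by the iterations `1, 2, …`) to the iterations
`1, …, t`. The value at `0` is not used. -/
def firstIter {A : Type*} (s : ℕ → A) (t : ℕ) : Fin t → A := fun i => s (i + 1)

/-- `lcb … t p` is the lower confidence bound `l_{t-1}(p) = μ_{t-1}(p) - β_t^{1/2} σ_{t-1}(p)`,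
for `t ≥ 1`, where `q` and `y` are the sequences of queries and of observations. -/
def lcb {D : Type*} (k : D → D → ℝ) (σ B δ : ℝ) (q : ℕ → D) (y : ℕ → ℝ) (t : ℕ) (p : D) : ℝ :=
  postMean k σ (firstIter q (t - 1)) (firstIter y (t - 1)) p
    - √(beta k σ B δ t) * postStd k σ (firstIter q (t - 1)) p

/-- `ucb … t p` is the upper confidence bound `u_{t-1}(p) = μ_{t-1}(p) + β_t^{1/2} σ_{t-1}(p)`,
for `t ≥ 1`. -/
def ucb {D : Type*} (k : D → D → ℝ) (σ B δ : ℝ) (q : ℕ → D) (y : ℕ → ℝ) (t : ℕ) (p : D) : ℝ :=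
  postMean k σ (firstIter q (t - 1)) (firstIter y (t - 1)) p
    + √(beta k σ B δ t) * postStd k σ (firstIter q (t - 1)) p

/-- `V_α(h(x, Z))` for a function `h` on `D_x × D_z`, where `P` is the law of `Z` as a measure on
`D_z`. -/
def varAt {X Z : Type*} [MeasurableSpace Z] (P : Measure Z) (α : ℝ) (h : X × Z → ℝ) (x : X) : ℝ :=
  valueAtRisk P α fun z => h (x, z)

/-- `z` is a lacing value with respect to `x`, for the lower bound `l` and the upper bound `u`. -/
def IsLacingValue {X Z : Type*} [MeasurableSpace Z] (P : Measure Z) (α : ℝ) (l u : X × Z → ℝ)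
    (x : X) (z : Z) : Prop :=
  l (x, z) ≤ varAt P α l x ∧ varAt P α l x ≤ varAt P α u x ∧ varAt P α u x ≤ u (x, z)

/-- The instantaneous regret `r(x) = V_α(f(x_*, Z)) - V_α(f(x, Z))`. -/
def regret {X Z : Type*} [MeasurableSpace Z] (P : Measure Z) (α : ℝ) (f : X × Z → ℝ)
    (xstar x : X) : ℝ :=
  varAt P α f xstar - varAt P α f x

/-- The constant `C₁ = 8 / log (1 + σ⁻²)`. -/
def regretConst (σ : ℝ) : ℝ := 8 / Real.log (1 + (σ ^ 2)⁻¹)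

/-- The law `P` of `Z`, seen as a measure on its support `D_z`. -/
def lawOnSupport {d : ℕ} (P : Measure (EuclideanSpace ℝ (Fin d))) : Measure P.support :=
  P.comap Subtype.val

end

end VUCB

/-! Regret. Suppose `l ≤ f ≤ u` holds at every iteration. Value-at-risk is monotone, so for each `t
≤ T` the value at `x_*` is at most that of `u` at `x_t`, hence at most `u (x_t, z_t)` by lacing. In
the same way `l (x_t, z_t)` is at most the best lower value-at-risk, hence at most the true value at
the recommended input. One and the same regret is therefore below the width of every one of the `T`
intervals. Squaring, averaging over `t` and bounding the sum of posterior variances by the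
information gain gives the bound (`le_sqrt_of_forall_le_width`, `sum_postVar_le`).

Confidence. Write the kernel as an inner product of feature vectors. The error of the posterior mean
splits into a bias, at most `‖f‖` times the posterior deviation, and a noise term, at most that
deviation times `√(noiseEnergy) / σ` (`abs_sub_postMean_le`). Next, `exp (noiseEnergy / (2 σ²) -
infoGain)` is the likelihood ratio of Gaussian process data against pure noise, evaluated at the
noise. It gains one Gaussian ratio per iteration, so it is a mean-one martingale even for adaptive
queries, and Ville's inequality controls it at all times on a single event
(`exists_noiseEnergy_lt`). -/

namespace VUCB

open Matrix
open scoped InnerProductSpace ENNReal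

/-! ### Posterior mean and variance through feature vectors -/

section Algebra

variable {D H : Type*} [NormedAddCommGroup H] [InnerProductSpace ℝ H] {k : D → D → ℝ} {φ : D → H}
  {σ : ℝ} {t : ℕ}

/-- The matrix `K + σ² I`. -/
noncomputable def noisyGram {D : Type*} (k : D → D → ℝ) (σ : ℝ) {t : ℕ} (q : Fin t → D) :
    Matrix (Fin t) (Fin t) ℝ :=
  gram k q + σ ^ 2 • (1 : Matrix (Fin t) (Fin t) ℝ)

theorem dotProduct_self_nonneg (b : Fin t → ℝ) : 0 ≤ b ⬝ᵥ b :=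
  Finset.sum_nonneg fun _ _ => mul_self_nonneg _

theorem crossCov_dotProduct (hk : ∀ p q, k p q = ⟪φ p, φ q⟫_ℝ) (q : Fin t → D) (p : D)
    (b : Fin t → ℝ) : crossCov k q p ⬝ᵥ b = ⟪φ p, ∑ i, b i • φ (q i)⟫_ℝ := by
  simp [dotProduct, crossCov, hk, inner_sum, inner_smul_right, mul_comm]

theorem gram_mulVec (q : Fin t → D) (b : Fin t → ℝ) (i : Fin t) :
    (gram k q *ᵥ b) i = crossCov k q (q i) ⬝ᵥ b := rfl

theorem dotProduct_gram_mulVec (hk : ∀ p q, k p q = ⟪φ p, φ q⟫_ℝ) (q : Fin t → D)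
    (a b : Fin t → ℝ) :
    a ⬝ᵥ gram k q *ᵥ b = ⟪∑ i, a i • φ (q i), ∑ i, b i • φ (q i)⟫_ℝ := by
  simp only [dotProduct, gram_mulVec]
  rw [sum_inner]
  refine Finset.sum_congr rfl fun i _ => ?_
  rw [real_inner_smul_left, ← crossCov_dotProduct hk]
  rfl

theorem noisyGram_mulVec (q : Fin t → D) (b : Fin t → ℝ) :
    noisyGram k σ q *ᵥ b = gram k q *ᵥ b + σ ^ 2 • b := by
  simp [noisyGram, add_mulVec, smul_mulVec]

theorem posSemidef_gram (hk : ∀ p q, k p q = ⟪φ p, φ q⟫_ℝ) (q : Fin t → D) :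
    (gram k q).PosSemidef := by
  refine PosSemidef.of_dotProduct_mulVec_nonneg ?_ fun a => ?_
  · ext i j
    simp [gram, hk, real_inner_comm]
  · rw [star_trivial, dotProduct_gram_mulVec hk]
    exact real_inner_self_nonneg

theorem posDef_noisyGram (hk : ∀ p q, k p q = ⟪φ p, φ q⟫_ℝ) (hσ : 0 < σ) (q : Fin t → D) :
    (noisyGram k σ q).PosDef :=
  PosDef.posSemidef_add (posSemidef_gram hk q) (PosDef.one.smul (by positivity))

theorem noisyGram_mulVec_precision (hk : ∀ p q, k p q = ⟪φ p, φ q⟫_ℝ) (hσ : 0 < σ)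
    (q : Fin t → D) (b : Fin t → ℝ) : noisyGram k σ q *ᵥ (precision k σ q *ᵥ b) = b := by
  have h := (posDef_noisyGram hk hσ q).det_pos.ne'.isUnit
  change noisyGram k σ q *ᵥ ((noisyGram k σ q)⁻¹ *ᵥ b) = b
  rw [mulVec_mulVec, mul_nonsing_inv _ h, one_mulVec]

theorem precision_mulVec_noisyGram (hk : ∀ p q, k p q = ⟪φ p, φ q⟫_ℝ) (hσ : 0 < σ)
    (q : Fin t → D) (b : Fin t → ℝ) : precision k σ q *ᵥ (noisyGram k σ q *ᵥ b) = b := by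
  have h := (posDef_noisyGram hk hσ q).det_pos.ne'.isUnit
  change (noisyGram k σ q)⁻¹ *ᵥ (noisyGram k σ q *ᵥ b) = b
  rw [mulVec_mulVec, nonsing_inv_mul _ h, one_mulVec]

theorem dotProduct_noisyGram_comm (hk : ∀ p q, k p q = ⟪φ p, φ q⟫_ℝ) (q : Fin t → D)
    (a b : Fin t → ℝ) : a ⬝ᵥ noisyGram k σ q *ᵥ b = b ⬝ᵥ noisyGram k σ q *ᵥ a := by
  simp only [noisyGram_mulVec, dotProduct_add, dotProduct_gram_mulVec hk, dotProduct_smul]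
  rw [real_inner_comm, dotProduct_comm a b]

theorem dotProduct_precision_comm (hk : ∀ p q, k p q = ⟪φ p, φ q⟫_ℝ) (hσ : 0 < σ)
    (q : Fin t → D) (a b : Fin t → ℝ) :
    a ⬝ᵥ precision k σ q *ᵥ b = b ⬝ᵥ precision k σ q *ᵥ a := by
  have h := dotProduct_noisyGram_comm (σ := σ) hk q (precision k σ q *ᵥ a) (precision k σ q *ᵥ b)
  rw [noisyGram_mulVec_precision hk hσ, noisyGram_mulVec_precision hk hσ] at h
  rw [dotProduct_comm, ← h, dotProduct_comm]

/-- The component of `φ p` not explained by the observations. -/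
noncomputable def residual (k : D → D → ℝ) (φ : D → H) (σ : ℝ) (q : Fin t → D) (p : D) : H :=
  φ p - ∑ i, (precision k σ q *ᵥ crossCov k q p) i • φ (q i)

/-- The weights `a` solve `(K + σ² I) a = crossCov`, so what `K a` leaves unexplained is exactly `σ²
a`. -/
theorem inner_residual (hk : ∀ p q, k p q = ⟪φ p, φ q⟫_ℝ) (hσ : 0 < σ) (q : Fin t → D) (p : D)
    (b : Fin t → ℝ) : ⟪residual k φ σ q p, ∑ i, b i • φ (q i)⟫_ℝ
      = σ ^ 2 * ((precision k σ q *ᵥ crossCov k q p) ⬝ᵥ b) := by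
  set a := precision k σ q *ᵥ crossCov k q p with ha
  have h : gram k q *ᵥ a + σ ^ 2 • a = crossCov k q p := by
    rw [← noisyGram_mulVec, noisyGram_mulVec_precision hk hσ]
  rw [residual, ← ha, inner_sub_left, ← crossCov_dotProduct hk, ← h, add_dotProduct,
    smul_dotProduct, dotProduct_comm, dotProduct_gram_mulVec hk, real_inner_comm, smul_eq_mul]
  ring

/-- The posterior variance is `⟪φ p, r⟫` with `r` the residual; splitting `φ p` into `r` and its
explained part leaves a cross term given by `inner_residual`. -/
theorem postVar_eq (hk : ∀ p q, k p q = ⟪φ p, φ q⟫_ℝ) (hσ : 0 < σ) (q : Fin t → D) (p : D) :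
    postVar k σ q p = ‖residual k φ σ q p‖ ^ 2
      + σ ^ 2 * ((precision k σ q *ᵥ crossCov k q p) ⬝ᵥ (precision k σ q *ᵥ crossCov k q p)) := by
  have h := inner_residual hk hσ q p (precision k σ q *ᵥ crossCov k q p)
  rw [← h, ← real_inner_self_eq_norm_sq, ← inner_add_right]
  conv_rhs => rw [residual]
  rw [sub_add_cancel, inner_sub_left, postVar, hk, real_inner_comm (φ p) (∑ i, _),
    crossCov_dotProduct hk]

theorem postVar_nonneg (hk : ∀ p q, k p q = ⟪φ p, φ q⟫_ℝ) (hσ : 0 < σ) (q : Fin t → D) (p : D) :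
    0 ≤ postVar k σ q p := by
  rw [postVar_eq hk hσ]
  have := dotProduct_self_nonneg (precision k σ q *ᵥ crossCov k q p)
  positivity

theorem postVar_le (hk : ∀ p q, k p q = ⟪φ p, φ q⟫_ℝ) (hσ : 0 < σ) (q : Fin t → D) (p : D) :
    postVar k σ q p ≤ k p p := by
  have h := (posDef_noisyGram hk hσ q).inv.posSemidef.dotProduct_mulVec_nonneg (crossCov k q p)
  rw [star_trivial] at h
  exact sub_le_self _ h

/-- The log-likelihood exponent `εᵀ (I - σ² (K + σ² I)⁻¹) ε = εᵀ K (K + σ² I)⁻¹ ε`. -/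
noncomputable def noiseEnergy (k : D → D → ℝ) (σ : ℝ) (q : Fin t → D) (e : Fin t → ℝ) : ℝ :=
  e ⬝ᵥ e - σ ^ 2 * (e ⬝ᵥ precision k σ q *ᵥ e)

/-- This is Cauchy–Schwarz in `H ⊕ ℝᵗ`. With `b = Λ e`, `h = ∑ bᵢ φ(qᵢ)` and `g = K b`, the left
side pairs `(r, σ a)` with `(h, g / σ)`. The squared norms of these vectors are the posterior
variance and `noiseEnergy / σ²`. -/
theorem abs_crossCov_dotProduct_precision_le (hk : ∀ p q, k p q = ⟪φ p, φ q⟫_ℝ) (hσ : 0 < σ)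
    (q : Fin t → D) (p : D) (e : Fin t → ℝ) :
    |crossCov k q p ⬝ᵥ precision k σ q *ᵥ e|
      ≤ postStd k σ q p * (√(noiseEnergy k σ q e) / σ) := by
  set a := precision k σ q *ᵥ crossCov k q p with ha
  set b := precision k σ q *ᵥ e with hb
  set h : H := ∑ i, b i • φ (q i) with hh
  set g := gram k q *ᵥ b with hg
  have he : g + σ ^ 2 • b = e := by
    rw [hg, ← noisyGram_mulVec, hb, noisyGram_mulVec_precision hk hσ]
  have hbg : b ⬝ᵥ g = ‖h‖ ^ 2 := by
    rw [hg, dotProduct_gram_mulVec hk, real_inner_self_eq_norm_sq]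
  have hE : noiseEnergy k σ q e = σ ^ 2 * ‖h‖ ^ 2 + g ⬝ᵥ g := by
    rw [noiseEnergy, ← hb, ← he, ← hbg]
    simp only [add_dotProduct, dotProduct_add, smul_dotProduct, dotProduct_smul, smul_eq_mul,
      dotProduct_comm g b]
    ring
  have hr := inner_residual hk hσ q p b
  rw [← ha, ← hh] at hr
  have hkey : crossCov k q p ⬝ᵥ b = ⟪residual k φ σ q p, h⟫_ℝ + a ⬝ᵥ g := by
    rw [hr, hb, dotProduct_precision_comm hk hσ, ← ha, ← hb]
    nth_rw 1 [← he]
    simp only [add_dotProduct, smul_dotProduct, smul_eq_mul, dotProduct_comm g a,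
      dotProduct_comm b a]
    ring
  set r := residual k φ σ q p with hrdef
  have hV : postVar k σ q p = ‖r‖ ^ 2 + σ ^ 2 * (a ⬝ᵥ a) := postVar_eq hk hσ q p
  have hagsq : (a ⬝ᵥ g) ^ 2 ≤ (a ⬝ᵥ a) * (g ⬝ᵥ g) := by
    simpa [dotProduct, sq] using Finset.sum_mul_sq_le_sq_mul_sq Finset.univ a g
  have haa := dotProduct_self_nonneg a
  have hgg := dotProduct_self_nonneg g
  have hag : |a ⬝ᵥ g| ≤ √(a ⬝ᵥ a) * √(g ⬝ᵥ g) := by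
    rw [← Real.sqrt_mul haa]; exact Real.abs_le_sqrt hagsq
  have hrh := abs_real_inner_le_norm r h
  have h1 : |crossCov k q p ⬝ᵥ b| ≤ ‖r‖ * ‖h‖ + √(a ⬝ᵥ a) * √(g ⬝ᵥ g) := by
    rw [hkey]
    exact (abs_add_le _ _).trans (add_le_add hrh hag)
  refine h1.trans ?_
  have hσ' : √(noiseEnergy k σ q e) / σ = √(noiseEnergy k σ q e / σ ^ 2) := by
    rw [Real.sqrt_div' _ (by positivity), Real.sqrt_sq hσ.le]
  rw [postStd, hV, hσ', hE,
    ← Real.sqrt_mul (by positivity : 0 ≤ ‖r‖ ^ 2 + σ ^ 2 * (a ⬝ᵥ a))]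
  refine Real.le_sqrt_of_sq_le ?_
  obtain ⟨A, hA, hA0⟩ : ∃ A, A ^ 2 = a ⬝ᵥ a ∧ 0 ≤ A := ⟨_, Real.sq_sqrt haa, Real.sqrt_nonneg _⟩
  obtain ⟨G, hG, hG0⟩ : ∃ A, A ^ 2 = g ⬝ᵥ g ∧ 0 ≤ A := ⟨_, Real.sq_sqrt hgg, Real.sqrt_nonneg _⟩
  rw [← hA, ← hG, Real.sqrt_sq hA0, Real.sqrt_sq hG0]
  -- Lagrange's identity for the plane vectors `(‖r‖, σ A)` and `(‖h‖, G / σ)`.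
  have : (‖r‖ ^ 2 + σ ^ 2 * A ^ 2) * ((σ ^ 2 * ‖h‖ ^ 2 + G ^ 2) / σ ^ 2)
      = (‖r‖ * ‖h‖ + A * G) ^ 2 + (‖r‖ * G / σ - σ * A * ‖h‖) ^ 2 := by
    field_simp
    ring
  rw [this]
  exact le_add_of_nonneg_right (sq_nonneg _)

/-- The deterministic part of the confidence bound: the error of the posterior mean of the noisy
observations of `x ↦ ⟪f, φ x⟫`. -/
theorem abs_sub_postMean_le (hk : ∀ p q, k p q = ⟪φ p, φ q⟫_ℝ) (hσ : 0 < σ) (q : Fin t → D)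
    (p : D) (e : Fin t → ℝ) (f : H) :
    |⟪f, φ p⟫_ℝ - postMean k σ q (fun i => ⟪f, φ (q i)⟫_ℝ + e i) p|
      ≤ (‖f‖ + √(noiseEnergy k σ q e) / σ) * postStd k σ q p := by
  have h1 : postMean k σ q (fun i => ⟪f, φ (q i)⟫_ℝ + e i) p
      = ⟪f, φ p - residual k φ σ q p⟫_ℝ + crossCov k q p ⬝ᵥ precision k σ q *ᵥ e := by
    have : (fun i => ⟪f, φ (q i)⟫_ℝ + e i) = (fun i => ⟪f, φ (q i)⟫_ℝ) + e := rfl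
    rw [postMean, this, mulVec_add, dotProduct_add, dotProduct_precision_comm hk hσ, residual,
      sub_sub_cancel, inner_sum]
    simp [dotProduct, inner_smul_right, mul_comm]
  -- Noise-free data would predict `⟪f, φ p - r⟫`, so the bias is the pairing of `f` with the
  -- residual.
  have h2 : ⟪f, φ p⟫_ℝ - postMean k σ q (fun i => ⟪f, φ (q i)⟫_ℝ + e i) p
      = ⟪f, residual k φ σ q p⟫_ℝ - crossCov k q p ⬝ᵥ precision k σ q *ᵥ e := by
    rw [h1, inner_sub_right]; ring
  have h3 : ‖residual k φ σ q p‖ ≤ postStd k σ q p := by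
    refine Real.le_sqrt_of_sq_le ?_
    rw [postVar_eq hk hσ]
    have := dotProduct_self_nonneg (precision k σ q *ᵥ crossCov k q p)
    exact le_add_of_nonneg_right (by positivity)
  rw [h2, add_mul]
  refine (abs_sub _ _).trans (add_le_add ?_ ?_)
  · exact (abs_real_inner_le_norm _ _).trans (by gcongr)
  · rw [mul_comm]
    exact abs_crossCov_dotProduct_precision_le hk hσ q p e

end Algebra

/-! ### One-step updates and the information gain -/

section Recursion

variable {D H : Type*} [NormedAddCommGroup H] [InnerProductSpace ℝ H] {k : D → D → ℝ} {φ : D → H}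
  {σ : ℝ} {t : ℕ}

theorem firstIter_succ {A : Type*} (s : ℕ → A) (t : ℕ) :
    firstIter s (t + 1) = (Fin.snoc (firstIter s t) (s (t + 1)) : Fin (t + 1) → A) := by
  ext i
  refine Fin.lastCases ?_ (fun i => ?_) i <;> simp [firstIter]

theorem dotProduct_snoc (a b : Fin t → ℝ) (x y : ℝ) :
    (Fin.snoc a x : Fin (t + 1) → ℝ) ⬝ᵥ (Fin.snoc b y : Fin (t + 1) → ℝ) = a ⬝ᵥ b + x * y := by
  simp [dotProduct, Fin.sum_univ_castSucc]

theorem crossCov_snoc (q : Fin t → D) (p p' : D) :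
    crossCov k (Fin.snoc q p : Fin (t + 1) → D) p' = Fin.snoc (crossCov k q p') (k p' p) := by
  ext i
  refine Fin.lastCases ?_ (fun i => ?_) i <;> simp [crossCov]

theorem noisyGram_snoc_mulVec (hk : ∀ p q, k p q = ⟪φ p, φ q⟫_ℝ) (q : Fin t → D) (p : D)
    (b : Fin t → ℝ) (c : ℝ) :
    noisyGram k σ (Fin.snoc q p : Fin (t + 1) → D) *ᵥ (Fin.snoc b c : Fin (t + 1) → ℝ)
      = Fin.snoc (noisyGram k σ q *ᵥ b + c • crossCov k q p)
        (crossCov k q p ⬝ᵥ b + (k p p + σ ^ 2) * c) := by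
  ext i
  rw [noisyGram_mulVec, noisyGram_mulVec]
  refine Fin.lastCases ?_ (fun i => ?_) i
  · simp only [Pi.add_apply, gram_mulVec, Pi.smul_apply, Fin.snoc_last, crossCov_snoc,
      dotProduct_snoc, smul_eq_mul]
    ring
  · have : crossCov k q p i = k (q i) p := by simp [crossCov, hk, real_inner_comm]
    simp only [Pi.add_apply, gram_mulVec, Pi.smul_apply, Fin.snoc_castSucc, crossCov_snoc,
      dotProduct_snoc, smul_eq_mul, this]
    ring

/-- Adding an observation raises `eᵀ Λ e` by the squared innovation over its predictive variance.
This is what makes the likelihood ratio factor over iterations. -/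
theorem noiseEnergy_snoc (hk : ∀ p q, k p q = ⟪φ p, φ q⟫_ℝ) (hσ : 0 < σ) (q : Fin t → D) (p : D)
    (e : Fin t → ℝ) (x : ℝ) :
    noiseEnergy k σ (Fin.snoc q p : Fin (t + 1) → D) (Fin.snoc e x : Fin (t + 1) → ℝ)
      = noiseEnergy k σ q e + x ^ 2
        - σ ^ 2 * ((x - postMean k σ q e p) ^ 2 / (σ ^ 2 + postVar k σ q p)) := by
  have hs : 0 < σ ^ 2 + postVar k σ q p := by
    have := postVar_nonneg hk hσ q p
    positivity
  set m := postMean k σ q e p with hm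
  set c := (x - m) / (σ ^ 2 + postVar k σ q p) with hc
  set a := precision k σ q *ᵥ crossCov k q p with ha
  set b := precision k σ q *ᵥ e with hb
  have hxm : c * (σ ^ 2 + postVar k σ q p) = x - m := div_mul_cancel₀ _ hs.ne'
  have hcb : crossCov k q p ⬝ᵥ b = m := rfl
  have hca : crossCov k q p ⬝ᵥ a = k p p - postVar k σ q p := by rw [postVar]; ring
  -- Block elimination in the bordered system: the last coordinate is the innovation divided by the
  -- Schur complement `σ² + postVar`.
  have hsol : noisyGram k σ (Fin.snoc q p : Fin (t + 1) → D) *ᵥ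
      (Fin.snoc (b - c • a) c : Fin (t + 1) → ℝ) = Fin.snoc e x := by
    rw [noisyGram_snoc_mulVec hk, mulVec_sub, mulVec_smul, ha, hb,
      noisyGram_mulVec_precision hk hσ, noisyGram_mulVec_precision hk hσ, sub_add_cancel,
      ← ha, ← hb, dotProduct_sub, dotProduct_smul, hcb, hca, smul_eq_mul]
    congr 1
    linear_combination hxm
  have hprec : precision k σ (Fin.snoc q p : Fin (t + 1) → D) *ᵥ
      (Fin.snoc e x : Fin (t + 1) → ℝ) = Fin.snoc (b - c • a) c := by
    rw [← hsol, precision_mulVec_noisyGram hk hσ]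
  have hea : e ⬝ᵥ a = m := by rw [ha, dotProduct_precision_comm hk hσ, ← hb, hcb]
  have hq : (x - m) ^ 2 / (σ ^ 2 + postVar k σ q p) = c * (x - m) := by rw [hc]; ring
  rw [noiseEnergy, hprec, dotProduct_snoc, dotProduct_snoc, dotProduct_sub, dotProduct_smul, hea,
    hq, noiseEnergy, smul_eq_mul]
  ring

/-- The predictive variance is the Schur complement of the old block. -/
theorem det_noisyGram_snoc (hk : ∀ p q, k p q = ⟪φ p, φ q⟫_ℝ) (hσ : 0 < σ) (q : Fin t → D)
    (p : D) : (noisyGram k σ (Fin.snoc q p : Fin (t + 1) → D)).det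
      = (noisyGram k σ q).det * (σ ^ 2 + postVar k σ q p) := by
  have hu : IsUnit (noisyGram k σ q).det := (posDef_noisyGram hk hσ q).det_pos.ne'.isUnit
  let _ : Invertible (noisyGram k σ q) := invertibleOfIsUnitDet _ hu
  have hb : (noisyGram k σ (Fin.snoc q p : Fin (t + 1) → D)).submatrix
        (finSumFinEquiv (m := t) (n := 1)) (finSumFinEquiv (m := t) (n := 1))
      = fromBlocks (noisyGram k σ q) (replicateCol (Fin 1) (crossCov k q p))
          (replicateRow (Fin 1) (crossCov k q p)) (of fun _ _ => k p p + σ ^ 2) := by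
    have h1 : ∀ i : Fin t, Fin.castAdd 1 i = i.castSucc := fun _ => rfl
    have h2 : ∀ j : Fin 1, Fin.natAdd t j = Fin.last t := fun j => by
      ext; simp
    have h3 : ∀ i : Fin t, k (q i) p = k p (q i) := fun i => by simp [hk, real_inner_comm]
    have h4 : ∀ i j : Fin t, (1 : Matrix (Fin (t + 1)) (Fin (t + 1)) ℝ) i.castSucc j.castSucc
        = (1 : Matrix (Fin t) (Fin t) ℝ) i j := fun i j => by simp [one_apply]
    ext (i | i) (j | j)
    · simp [noisyGram, gram, h1, h4]
    · simp [noisyGram, gram, h1, h2, h3, crossCov, one_apply, Fin.ext_iff, i.2.ne]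
    · simp [noisyGram, gram, h1, h2, crossCov, one_apply, Fin.ext_iff, j.2.ne']
    · simp [noisyGram, gram, h2]
  rw [← det_submatrix_equiv_self (finSumFinEquiv (m := t) (n := 1)), hb, det_fromBlocks₁₁,
    det_fin_one]
  congr 1
  simp only [invOf_eq_nonsing_inv, Matrix.sub_apply, postVar]
  rw [Matrix.mul_assoc]
  change k p p + σ ^ 2 - crossCov k q p ⬝ᵥ (precision k σ q *ᵥ crossCov k q p) = _
  ring

theorem det_one_add_gram (hσ : 0 < σ) (q : Fin t → D) :
    (1 + (σ ^ 2)⁻¹ • gram k q).det = ((σ ^ 2)⁻¹) ^ t * (noisyGram k σ q).det := by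
  have : 1 + (σ ^ 2)⁻¹ • gram k q = (σ ^ 2)⁻¹ • noisyGram k σ q := by
    rw [noisyGram, smul_add, smul_smul, inv_mul_cancel₀ (by positivity), one_smul, add_comm]
  rw [this, det_smul, Fintype.card_fin]

theorem infoGain_snoc (hk : ∀ p q, k p q = ⟪φ p, φ q⟫_ℝ) (hσ : 0 < σ) (q : Fin t → D) (p : D) :
    infoGain k σ (Fin.snoc q p : Fin (t + 1) → D)
      = infoGain k σ q + 1 / 2 * Real.log (1 + (σ ^ 2)⁻¹ * postVar k σ q p) := by
  have h1 := postVar_nonneg hk hσ q p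
  have h2 := (posDef_noisyGram hk hσ q).det_pos
  have h3 : (1 + (σ ^ 2)⁻¹ • gram k (Fin.snoc q p : Fin (t + 1) → D)).det
      = (1 + (σ ^ 2)⁻¹ • gram k q).det * (1 + (σ ^ 2)⁻¹ * postVar k σ q p) := by
    rw [det_one_add_gram hσ, det_one_add_gram hσ, det_noisyGram_snoc hk hσ, pow_succ]
    field_simp
  rw [infoGain, h3, Real.log_mul, infoGain, mul_add]
  · rw [det_one_add_gram hσ]; positivity
  · positivity

theorem infoGain_zero (q : Fin 0 → D) : infoGain k σ q = 0 := by simp [infoGain]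

theorem infoGain_firstIter (hk : ∀ p q, k p q = ⟪φ p, φ q⟫_ℝ) (hσ : 0 < σ) (s : ℕ → D) (T : ℕ) :
    infoGain k σ (firstIter s T) = ∑ t ∈ Finset.range T,
      1 / 2 * Real.log (1 + (σ ^ 2)⁻¹ * postVar k σ (firstIter s t) (s (t + 1))) := by
  induction T with
  | zero => simp [infoGain_zero]
  | succ T ih => rw [firstIter_succ, infoGain_snoc hk hσ, ih, Finset.sum_range_succ]

theorem log_one_add_postVar_nonneg (hk : ∀ p q, k p q = ⟪φ p, φ q⟫_ℝ) (hσ : 0 < σ)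
    (q : Fin t → D) (p : D) : 0 ≤ Real.log (1 + (σ ^ 2)⁻¹ * postVar k σ q p) := by
  have := postVar_nonneg hk hσ q p
  exact Real.log_nonneg (le_add_of_nonneg_right (by positivity))

/-- This crude linear bound makes the supremum defining `maxInfoGain` a genuine one; an unbounded
`⨆` would default to `0`. -/
theorem infoGain_le (hk : ∀ p q, k p q = ⟪φ p, φ q⟫_ℝ) (hk1 : ∀ p, k p p ≤ 1) (hσ : 0 < σ)
    (q : Fin t → D) : infoGain k σ q ≤ t * (1 / 2 * Real.log (1 + (σ ^ 2)⁻¹)) := by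
  induction t with
  | zero => simp [infoGain_zero]
  | succ t ih =>
    have h0 := postVar_nonneg hk hσ (Fin.init q) (q (Fin.last t))
    have h1 := (postVar_le hk hσ (Fin.init q) (q (Fin.last t))).trans (hk1 _)
    have h2 : Real.log (1 + (σ ^ 2)⁻¹ * postVar k σ (Fin.init q) (q (Fin.last t)))
        ≤ Real.log (1 + (σ ^ 2)⁻¹) := by
      refine Real.log_le_log (by positivity) ?_
      gcongr
      exact mul_le_of_le_one_right (by positivity) h1
    have h3 := ih (Fin.init q)
    rw [← Fin.snoc_init_self q, infoGain_snoc hk hσ]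
    push_cast
    linarith

theorem infoGain_le_maxInfoGain (hk : ∀ p q, k p q = ⟪φ p, φ q⟫_ℝ) (hk1 : ∀ p, k p p ≤ 1)
    (hσ : 0 < σ) (q : Fin t → D) : infoGain k σ q ≤ maxInfoGain k σ t :=
  le_ciSup (f := fun q : Fin t → D => infoGain k σ q)
    ⟨_, Set.forall_mem_range.2 fun q => infoGain_le hk hk1 hσ q⟩ q

theorem maxInfoGain_mono [Nonempty D] (hk : ∀ p q, k p q = ⟪φ p, φ q⟫_ℝ) (hk1 : ∀ p, k p p ≤ 1)
    (hσ : 0 < σ) : Monotone (maxInfoGain k σ) := by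
  refine monotone_nat_of_le_succ fun t => ciSup_le fun q => ?_
  obtain ⟨p⟩ := ‹Nonempty D›
  refine le_trans ?_ (infoGain_le_maxInfoGain hk hk1 hσ (Fin.snoc q p : Fin (t + 1) → D))
  rw [infoGain_snoc hk hσ]
  have := log_one_add_postVar_nonneg hk hσ q p
  linarith

/-- Concavity of the logarithm on the chord from `1` to `1 + c`. -/
theorem mul_log_one_add_le {c s : ℝ} (hc : 0 ≤ c) (hs0 : 0 ≤ s) (hs1 : s ≤ 1) :
    s * Real.log (1 + c) ≤ Real.log (1 + c * s) := by
  have h := strictConcaveOn_log_Ioi.concaveOn.2 (Set.mem_Ioi.2 one_pos)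
    (Set.mem_Ioi.2 (by positivity : 0 < 1 + c)) (sub_nonneg.2 hs1) hs0 (sub_add_cancel 1 s)
  simp only [smul_eq_mul, Real.log_one, mul_zero, zero_add, mul_one] at h
  refine h.trans_eq (congrArg _ ?_)
  ring

/-- Variances are at most `1`, so each is at most its log-determinant increment divided by `log (1 +
σ⁻²)`. The constant `8` is the `4` here times `2`, which undoes the one half in the information
gain. -/
theorem sum_postVar_le (hk : ∀ p q, k p q = ⟪φ p, φ q⟫_ℝ) (hk1 : ∀ p, k p p ≤ 1) (hσ : 0 < σ)
    (s : ℕ → D) (T : ℕ) :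
    ∑ t ∈ Finset.range T, 4 * postVar k σ (firstIter s t) (s (t + 1))
      ≤ regretConst σ * maxInfoGain k σ T := by
  have hL : 0 < Real.log (1 + (σ ^ 2)⁻¹) :=
    Real.log_pos (lt_add_of_pos_right _ (by positivity))
  rw [regretConst, div_mul_eq_mul_div, le_div_iff₀ hL, Finset.sum_mul]
  refine le_trans ?_ (mul_le_mul_of_nonneg_left
    (infoGain_le_maxInfoGain hk hk1 hσ (firstIter s T)) (by norm_num))
  rw [infoGain_firstIter hk hσ, Finset.mul_sum]
  refine Finset.sum_le_sum fun t _ => ?_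
  have h := mul_log_one_add_le (c := (σ ^ 2)⁻¹) (by positivity)
    (postVar_nonneg hk hσ (firstIter s t) (s (t + 1))) ((postVar_le hk hσ _ _).trans (hk1 _))
  linarith

theorem sqrt_beta_eq {B δ : ℝ} (hB : 0 ≤ B) (t : ℕ) : √(beta k σ B δ t)
    = B + max 1 σ * √(2 * (maxInfoGain k σ (t - 1) + 1 + Real.log (1 / δ))) :=
  Real.sqrt_sq (by positivity)

theorem beta_mono [Nonempty D] {B δ : ℝ} (hk : ∀ p q, k p q = ⟪φ p, φ q⟫_ℝ)
    (hk1 : ∀ p, k p p ≤ 1) (hσ : 0 < σ) (hB : 0 ≤ B) : Monotone (beta k σ B δ) := by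
  intro s t hst
  have := maxInfoGain_mono hk hk1 hσ (Nat.sub_le_sub_right hst 1)
  unfold beta
  gcongr

end Recursion

/-! ### Continuity in the queries and observations -/

section Continuity

variable {D H : Type*} [TopologicalSpace D] [NormedAddCommGroup H] [InnerProductSpace ℝ H]
  {k : D → D → ℝ} {φ : D → H} {σ : ℝ} {t : ℕ}

theorem continuous_precision (hkc : Continuous (Function.uncurry k))
    (hk : ∀ p q, k p q = ⟪φ p, φ q⟫_ℝ) (hσ : 0 < σ) :
    Continuous fun q : Fin t → D => precision k σ q := by
  have hA : Continuous fun q : Fin t → D => noisyGram k σ q := by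
    refine Continuous.add (continuous_matrix fun i j => ?_) continuous_const
    exact hkc.comp (f := fun q : Fin t → D => (q i, q j))
      ((continuous_apply i).prodMk (continuous_apply j))
  -- Cramer's rule reduces continuity of the inverse to that of the determinant and the adjugate.
  have h : (fun q : Fin t → D => precision k σ q)
      = fun q => (noisyGram k σ q).det⁻¹ • (noisyGram k σ q).adjugate := by
    ext1 q
    rw [← Ring.inverse_eq_inv', ← Matrix.inv_def]
    rfl
  rw [h]
  exact (hA.matrix_det.inv₀ fun q => (posDef_noisyGram hk hσ q).det_pos.ne').smul
    hA.matrix_adjugate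

theorem continuous_crossCov (hkc : Continuous (Function.uncurry k)) :
    Continuous fun a : (Fin t → D) × D => crossCov k a.1 a.2 :=
  continuous_pi fun i =>
    hkc.comp (continuous_snd.prodMk ((continuous_apply i).comp continuous_fst))

theorem continuous_postMean (hkc : Continuous (Function.uncurry k))
    (hk : ∀ p q, k p q = ⟪φ p, φ q⟫_ℝ) (hσ : 0 < σ) :
    Continuous fun a : ((Fin t → D) × D) × (Fin t → ℝ) => postMean k σ a.1.1 a.2 a.1.2 :=
  Continuous.dotProduct ((continuous_crossCov hkc).comp continuous_fst)
    (((continuous_precision hkc hk hσ).comp (continuous_fst.comp continuous_fst)).matrix_mulVec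
      continuous_snd)

theorem continuous_postVar (hkc : Continuous (Function.uncurry k))
    (hk : ∀ p q, k p q = ⟪φ p, φ q⟫_ℝ) (hσ : 0 < σ) :
    Continuous fun a : (Fin t → D) × D => postVar k σ a.1 a.2 :=
  (hkc.comp (continuous_snd.prodMk continuous_snd)).sub
    (Continuous.dotProduct (continuous_crossCov hkc)
      (((continuous_precision hkc hk hσ).comp continuous_fst).matrix_mulVec
        (continuous_crossCov hkc)))

theorem continuous_lcb (hkc : Continuous (Function.uncurry k))
    (hk : ∀ p q, k p q = ⟪φ p, φ q⟫_ℝ) (hσ : 0 < σ) (B δ : ℝ) (q : ℕ → D) (y : ℕ → ℝ) (t : ℕ) :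
    Continuous (lcb k σ B δ q y t) :=
  ((continuous_postMean hkc hk hσ).comp ((Continuous.prodMk_right _).prodMk continuous_const)).sub
    (continuous_const.mul
      (((continuous_postVar hkc hk hσ).comp (Continuous.prodMk_right _)).sqrt))

end Continuity

/-! ### Monotonicity of value-at-risk -/

section VaR

variable {E : Type*} [MeasurableSpace E] {P : Measure E} [IsProbabilityMeasure P] {α : ℝ}
  {g h : E → ℝ}

theorem tendsto_sublevel_atTop (h : E → ℝ) :
    Filter.Tendsto (fun n : ℕ => P.real {e | h e ≤ n}) Filter.atTop (nhds 1) := by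
  have hU : ⋃ n : ℕ, {e | h e ≤ n} = Set.univ :=
    Set.eq_univ_of_forall fun e => Set.mem_iUnion.2 (exists_nat_ge (h e))
  have := tendsto_measure_iUnion_atTop (μ := P) (s := fun n : ℕ => {e | h e ≤ n})
    fun m n hmn e (he : h e ≤ m) => he.trans (Nat.cast_le.2 hmn)
  rw [hU, measure_univ] at this
  exact (ENNReal.tendsto_toReal ENNReal.one_ne_top).comp this

theorem nonempty_valueAtRisk (hα : α < 1) (h : E → ℝ) :
    {w : ℝ | α ≤ P.real {e | h e ≤ w}}.Nonempty :=
  let ⟨n, hn⟩ := ((tendsto_sublevel_atTop (P := P) h).eventually (lt_mem_nhds hα)).exists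
  ⟨n, hn.le⟩

theorem bddBelow_valueAtRisk (hα : 0 < α) (hh : Measurable h) :
    BddBelow {w : ℝ | α ≤ P.real {e | h e ≤ w}} := by
  obtain ⟨n, hn⟩ := ((tendsto_sublevel_atTop (P := P) (fun e => -h e)).eventually
    (lt_mem_nhds (show 1 - α < 1 by linarith))).exists
  refine ⟨-n - 1, fun w hw => ?_⟩
  by_contra! hlt
  have hsub : {e | h e ≤ w} ⊆ {e | -h e ≤ n}ᶜ := fun e (he : h e ≤ w) (he' : -h e ≤ n) => by
    linarith
  have h1 := measureReal_mono (μ := P) hsub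
  rw [probReal_compl_eq_one_sub (measurableSet_le (f := fun e => -h e) hh.neg measurable_const)] at h1
  have hw : α ≤ P.real {e | h e ≤ w} := hw
  linarith

/-- A larger function has smaller sublevel sets. Since `sInf` has default values, the set for `g`
must be bounded below (from `0 < α`) and the set for `h` nonempty (from `α < 1`). -/
theorem valueAtRisk_mono (hα : α ∈ Set.Ioo (0 : ℝ) 1) (hg : Measurable g) (hgh : ∀ e, g e ≤ h e) :
    valueAtRisk P α g ≤ valueAtRisk P α h :=
  csInf_le_csInf (bddBelow_valueAtRisk hα.1 hg) (nonempty_valueAtRisk hα.2 h)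
    fun _ hw => le_trans hw (measureReal_mono fun e he => (hgh e).trans he)

theorem isProbabilityMeasure_lawOnSupport {d : ℕ} (P : Measure (EuclideanSpace ℝ (Fin d)))
    [IsProbabilityMeasure P] : IsProbabilityMeasure (lawOnSupport P) where
  measure_univ := by
    rw [lawOnSupport, comap_subtype_coe_apply P.isClosed_support.measurableSet,
      Set.image_univ, Subtype.range_coe]
    exact prob_compl_eq_zero_iff P.isClosed_support.measurableSet |>.1 P.measure_compl_support

end VaR

/-! ### Gaussian likelihood ratios and Ville's inequality -/

section Martingale

/-- The likelihood ratio of `N(m, σ² + s)` with respect to `N(0, σ²)`. -/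
noncomputable def gaussianRatio (σ m s x : ℝ) : ℝ :=
  Real.exp ((x ^ 2 - σ ^ 2 * ((x - m) ^ 2 / (σ ^ 2 + s))) / (2 * σ ^ 2)
    - 1 / 2 * Real.log (1 + (σ ^ 2)⁻¹ * s))

theorem gaussianPDFReal_mul_gaussianRatio {σ s : ℝ} (hσ : 0 < σ) (hs : 0 ≤ s) (m x : ℝ) :
    gaussianPDFReal 0 (Real.toNNReal (σ ^ 2)) x * gaussianRatio σ m s x
      = gaussianPDFReal m (Real.toNNReal (σ ^ 2 + s)) x := by
  have h1 : 0 < σ ^ 2 + s := by positivity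
  have h2 : 0 < 1 + (σ ^ 2)⁻¹ * s := by positivity
  have hlog : Real.exp (1 / 2 * Real.log (1 + (σ ^ 2)⁻¹ * s)) = √(1 + (σ ^ 2)⁻¹ * s) := by
    rw [Real.sqrt_eq_rpow, Real.rpow_def_of_pos h2, mul_comm]
  have hsq : √(2 * Real.pi * (σ ^ 2 + s)) = √(2 * Real.pi * σ ^ 2) * √(1 + (σ ^ 2)⁻¹ * s) := by
    rw [← Real.sqrt_mul (by positivity)]
    congr 1
    field_simp
  have hexp : -(x - 0) ^ 2 / (2 * σ ^ 2)
      + (x ^ 2 - σ ^ 2 * ((x - m) ^ 2 / (σ ^ 2 + s))) / (2 * σ ^ 2)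
      = -(x - m) ^ 2 / (2 * (σ ^ 2 + s)) := by
    field_simp
    ring
  rw [gaussianPDFReal, gaussianPDFReal, gaussianRatio, Real.coe_toNNReal _ (by positivity),
    Real.coe_toNNReal _ h1.le, hsq, Real.exp_sub, hlog, ← hexp, Real.exp_add]
  field_simp

theorem lintegral_gaussianRatio {σ s : ℝ} (hσ : 0 < σ) (hs : 0 ≤ s) (m : ℝ) :
    ∫⁻ x, ENNReal.ofReal (gaussianRatio σ m s x) ∂gaussianReal 0 (Real.toNNReal (σ ^ 2)) = 1 := by
  have h0 : Real.toNNReal (σ ^ 2) ≠ 0 := by simp; positivity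
  have h1 : Real.toNNReal (σ ^ 2 + s) ≠ 0 := by simp; positivity
  have hm : Measurable fun x => ENNReal.ofReal (gaussianRatio σ m s x) := by
    unfold gaussianRatio; fun_prop
  rw [gaussianReal_of_var_ne_zero _ h0,
    lintegral_withDensity_eq_lintegral_mul _ (measurable_gaussianPDF _ _) hm,
    ← lintegral_gaussianPDF_eq_one m h1]
  refine lintegral_congr fun x => ?_
  rw [Pi.mul_apply, gaussianPDF, gaussianPDF, ← ENNReal.ofReal_mul (gaussianPDFReal_nonneg _ _ _),
    gaussianPDFReal_mul_gaussianRatio hσ hs]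

/-- Conditionally on a σ-algebra independent of a Gaussian variable, the likelihood ratio with
respect to its law has mean one. -/
theorem lintegral_mul_gaussianRatio {Ω : Type*} {m₀ mΩ : MeasurableSpace Ω} {μ : Measure Ω}
    [IsProbabilityMeasure μ] {σ : ℝ} (hσ : 0 < σ) (hm₀ : m₀ ≤ mΩ)
    {e m s : Ω → ℝ} {W : Ω → ℝ≥0∞} (he : Measurable e)
    (hind : Indep (MeasurableSpace.comap e inferInstance) m₀ μ)
    (hlaw : μ.map e = gaussianReal 0 (Real.toNNReal (σ ^ 2)))
    (hm : Measurable[m₀] m) (hs : Measurable[m₀] s) (hs0 : ∀ ω, 0 ≤ s ω) (hW : Measurable[m₀] W) :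
    ∫⁻ ω, W ω * ENNReal.ofReal (gaussianRatio σ (m ω) (s ω) (e ω)) ∂μ = ∫⁻ ω, W ω ∂μ := by
  -- All the past data enter through `X`, which is independent of `e`; the joint law is a product,
  -- and Tonelli allows integrating over the noise with `X` frozen.
  let X : Ω → ℝ≥0∞ × ℝ × ℝ := fun ω => (W ω, m ω, s ω)
  have hX0 : Measurable[m₀] X := hW.prodMk (hm.prodMk hs)
  have hX : Measurable X := hX0.mono hm₀ le_rfl
  have hXe : IndepFun X e μ :=
    (indep_of_indep_of_le_right hind hX0.comap_le).symm
  have hmap := (indepFun_iff_map_prod_eq_prod_map_map hX.aemeasurable he.aemeasurable).1 hXe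
  let F : (ℝ≥0∞ × ℝ × ℝ) × ℝ → ℝ≥0∞ := fun a =>
    a.1.1 * ENNReal.ofReal (gaussianRatio σ a.1.2.1 a.1.2.2 a.2)
  have hF : Measurable F := by
    unfold F gaussianRatio; fun_prop
  have h1 : ∫⁻ ω, W ω * ENNReal.ofReal (gaussianRatio σ (m ω) (s ω) (e ω)) ∂μ
      = ∫⁻ a, F a ∂(μ.map fun ω => (X ω, e ω)) := (lintegral_map hF (hX.prodMk he)).symm
  rw [h1, hmap, lintegral_prod _ hF.aemeasurable,
    lintegral_map hF.lintegral_prod_right' hX, hlaw]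
  refine lintegral_congr fun ω => ?_
  have hr : Measurable fun x => ENNReal.ofReal (gaussianRatio σ (m ω) (s ω) x) := by
    unfold gaussianRatio; fun_prop
  change ∫⁻ x, W ω * ENNReal.ofReal (gaussianRatio σ (m ω) (s ω) x)
    ∂gaussianReal 0 (Real.toNNReal (σ ^ 2)) = W ω
  rw [lintegral_const_mul _ hr, lintegral_gaussianRatio hσ (hs0 ω), mul_one]

variable {Ω : Type*} [mΩ : MeasurableSpace Ω] {μ : Measure Ω} [IsProbabilityMeasure μ]

/-- Ville's inequality for a nonnegative martingale with mean one. -/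
theorem exists_measurableSet_forall_lt {ℱ : Filtration ℕ mΩ} {M : ℕ → Ω → ℝ}
    (hM : Martingale M ℱ μ) (hM0 : 0 ≤ M) (hM1 : ∀ t, ∫ ω, M t ω ∂μ = 1) {δ : ℝ} (hδ : 0 < δ) :
    ∃ E : Set Ω, MeasurableSet E ∧ 1 - δ ≤ μ.real E ∧ ∀ ω ∈ E, ∀ t, M t ω < 1 / δ := by
  have hmeas : ∀ t, Measurable (M t) := fun t => ((hM.1 t).measurable).mono (ℱ.le t) le_rfl
  let A : ℕ → Set Ω := fun n => ⋃ t ∈ Finset.range (n + 1), {ω | 1 / δ ≤ M t ω}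
  have hA : ∀ n, MeasurableSet (A n) := fun n =>
    Finset.measurableSet_biUnion _ fun t _ => measurableSet_le measurable_const (hmeas t)
  -- Doob's maximal inequality up to time `n`; the bound is uniform in `n`, hence passes to the
  -- increasing union.
  have hbound : ∀ n, μ (A n) ≤ ENNReal.ofReal δ := fun n => by
    let c : NNReal := Real.toNNReal (1 / δ)
    have hc : (c : ℝ) = 1 / δ := Real.coe_toNNReal _ (by positivity)
    have h := maximal_ineq hM.submartingale hM0 (ε := c) n
    have hset : {ω | (c : ℝ) ≤ (Finset.range (n + 1)).sup' Finset.nonempty_range_add_one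
        fun k => M k ω} = A n := by
      ext ω
      simp [A, hc, Finset.le_sup'_iff]
    rw [hset] at h
    have h2 : ∫ ω in A n, M n ω ∂μ ≤ 1 := by
      rw [← hM1 n]
      exact setIntegral_le_integral (hM.integrable n) (ae_of_all _ (hM0 n))
    have h3 : (c : ℝ≥0∞) * μ (A n) ≤ 1 :=
      h.trans (ENNReal.ofReal_le_one.2 h2)
    have h4 : ENNReal.ofReal δ * (c : ℝ≥0∞) = 1 := by
      change ENNReal.ofReal δ * ENNReal.ofReal (1 / δ) = 1
      rw [← ENNReal.ofReal_mul hδ.le, mul_one_div_cancel hδ.ne', ENNReal.ofReal_one]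
    calc μ (A n) = ENNReal.ofReal δ * ((c : ℝ≥0∞) * μ (A n)) := by rw [← mul_assoc, h4, one_mul]
      _ ≤ ENNReal.ofReal δ * 1 := by gcongr
      _ = ENNReal.ofReal δ := mul_one _
  have hmono : Monotone A := fun m n hmn =>
    Set.biUnion_subset_biUnion_left fun t ht => by
      simp only [Finset.coe_range, Set.mem_Iio] at ht ⊢
      lia
  refine ⟨(⋃ n, A n)ᶜ, (MeasurableSet.iUnion hA).compl, ?_, fun ω hω t => ?_⟩
  · have h := le_of_tendsto' (tendsto_measure_iUnion_atTop hmono) hbound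
    have h' : μ.real (⋃ n, A n) ≤ δ := ENNReal.toReal_le_of_le_ofReal hδ.le h
    rw [probReal_compl_eq_one_sub (MeasurableSet.iUnion hA)]
    linarith
  · by_contra! hlt
    exact hω (Set.mem_iUnion.2 ⟨t, Set.mem_biUnion (Finset.self_mem_range_succ t) hlt⟩)

end Martingale

/-! ### The noise energy under adaptive queries -/

section Confidence

/-- The likelihood ratio of the law of the noisy observations under the Gaussian process with
covariance `k` with respect to the law of the noise, evaluated at the noise `e`. -/
noncomputable def likelihoodRatio {D : Type*} (k : D → D → ℝ) (σ : ℝ) (q : ℕ → D) (e : ℕ → ℝ)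
    (t : ℕ) : ℝ :=
  Real.exp (noiseEnergy k σ (firstIter q t) (firstIter e t) / (2 * σ ^ 2)
    - infoGain k σ (firstIter q t))

/-- The new factor is the predictive Gaussian density against the noise density. The posterior mean
in it is fitted to the noise alone, not to the observations `y`. -/
theorem likelihoodRatio_succ {D H : Type*} [NormedAddCommGroup H] [InnerProductSpace ℝ H]
    {k : D → D → ℝ} {φ : D → H} {σ : ℝ} (hk : ∀ p q, k p q = ⟪φ p, φ q⟫_ℝ) (hσ : 0 < σ) (q : ℕ → D)
    (e : ℕ → ℝ) (t : ℕ) : likelihoodRatio k σ q e (t + 1) = likelihoodRatio k σ q e t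
      * gaussianRatio σ (postMean k σ (firstIter q t) (firstIter e t) (q (t + 1)))
        (postVar k σ (firstIter q t) (q (t + 1))) (e (t + 1)) := by
  rw [likelihoodRatio, likelihoodRatio, gaussianRatio, ← Real.exp_add, firstIter_succ,
    firstIter_succ, infoGain_snoc hk hσ, noiseEnergy_snoc hk hσ]
  congr 1
  ring

theorem likelihoodRatio_zero {D : Type*} (k : D → D → ℝ) (σ : ℝ) (q : ℕ → D) (e : ℕ → ℝ) :
    likelihoodRatio k σ q e 0 = 1 := by
  simp [likelihoodRatio, noiseEnergy, infoGain_zero]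

theorem measurable_gaussianRatio {Ω : Type*} {m₀ : MeasurableSpace Ω} (σ : ℝ) {m s x : Ω → ℝ}
    (hm : Measurable m) (hs : Measurable s) (hx : Measurable x) :
    Measurable fun ω => gaussianRatio σ (m ω) (s ω) (x ω) := by
  unfold gaussianRatio; fun_prop

variable {D H : Type*} [TopologicalSpace D] [SecondCountableTopology D] [MeasurableSpace D]
  [OpensMeasurableSpace D] [NormedAddCommGroup H] [InnerProductSpace ℝ H]
  {k : D → D → ℝ} {φ : D → H} {σ : ℝ}
  {Ω : Type*} [mΩ : MeasurableSpace Ω] {μ : Measure Ω} [IsProbabilityMeasure μ]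
  {ℱ : Filtration ℕ mΩ} {q : ℕ → Ω → D} {ε : ℕ → Ω → ℝ}

/-- The index map `r` covers both predictable queries (`r = Nat.pred`) and adapted noise (`r = id`).
-/
theorem measurable_firstIter {A : Type*} [MeasurableSpace A] {s : ℕ → Ω → A}
    {r : ℕ → ℕ} (hr : ∀ t, r t ≤ t) (hs : ∀ t, 1 ≤ t → Measurable[ℱ (r t)] (s t)) (t : ℕ) :
    Measurable[ℱ t] fun ω => firstIter (fun i => s i ω) t :=
  @measurable_pi_lambda _ _ _ (ℱ t) _ _ fun i =>
    (hs (i + 1) (Nat.le_add_left 1 i)).mono (ℱ.mono ((hr _).trans i.2)) le_rfl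

theorem measurable_postMean (hkc : Continuous (Function.uncurry k))
    (hk : ∀ p q, k p q = ⟪φ p, φ q⟫_ℝ) (hσ : 0 < σ)
    (hq : ∀ t, 1 ≤ t → Measurable[ℱ (t - 1)] (q t)) (hε : ∀ t, 1 ≤ t → Measurable[ℱ t] (ε t))
    (t : ℕ) : Measurable[ℱ t] fun ω => postMean k σ (firstIter (fun i => q i ω) t)
      (firstIter (fun i => ε i ω) t) (q (t + 1) ω) :=
  (continuous_postMean hkc hk hσ).measurable.comp
    (((measurable_firstIter Nat.pred_le hq t).prodMk (hq (t + 1) (Nat.le_add_left 1 t))).prodMk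
      (measurable_firstIter (fun _ => le_rfl) hε t))

theorem measurable_postVar (hkc : Continuous (Function.uncurry k))
    (hk : ∀ p q, k p q = ⟪φ p, φ q⟫_ℝ) (hσ : 0 < σ)
    (hq : ∀ t, 1 ≤ t → Measurable[ℱ (t - 1)] (q t)) (t : ℕ) :
    Measurable[ℱ t] fun ω => postVar k σ (firstIter (fun i => q i ω) t) (q (t + 1) ω) :=
  (continuous_postVar hkc hk hσ).measurable.comp
    ((measurable_firstIter Nat.pred_le hq t).prodMk (hq (t + 1) (Nat.le_add_left 1 t)))

theorem measurable_likelihoodRatio (hkc : Continuous (Function.uncurry k))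
    (hk : ∀ p q, k p q = ⟪φ p, φ q⟫_ℝ) (hσ : 0 < σ)
    (hq : ∀ t, 1 ≤ t → Measurable[ℱ (t - 1)] (q t)) (hε : ∀ t, 1 ≤ t → Measurable[ℱ t] (ε t))
    (t : ℕ) :
    Measurable[ℱ t] fun ω => likelihoodRatio k σ (fun i => q i ω) (fun i => ε i ω) t := by
  induction t with
  | zero => simp only [likelihoodRatio_zero, measurable_const]
  | succ t ih =>
    have hle := ℱ.mono (Nat.le_succ t)
    simp only [likelihoodRatio_succ hk hσ]
    exact (ih.mono hle le_rfl).mul (measurable_gaussianRatio σ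
      ((measurable_postMean hkc hk hσ hq hε t).mono hle le_rfl)
      ((measurable_postVar hkc hk hσ hq t).mono hle le_rfl) (hε (t + 1) (Nat.le_add_left 1 t)))

/-- The martingale property, tested on past events. The indicator of `A` joins the past weight, and
the new factor has mean one given the past. Lower integrals are used because integrability is
deduced afterwards. -/
theorem setLIntegral_likelihoodRatio_succ (hkc : Continuous (Function.uncurry k))
    (hk : ∀ p q, k p q = ⟪φ p, φ q⟫_ℝ) (hσ : 0 < σ)
    (hq : ∀ t, 1 ≤ t → Measurable[ℱ (t - 1)] (q t)) (hε : ∀ t, 1 ≤ t → Measurable[ℱ t] (ε t))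
    (hind : ∀ t, 1 ≤ t → Indep (MeasurableSpace.comap (ε t) inferInstance) (ℱ (t - 1)) μ)
    (hlaw : ∀ t, 1 ≤ t → μ.map (ε t) = gaussianReal 0 (Real.toNNReal (σ ^ 2)))
    (t : ℕ) {A : Set Ω} (hA : MeasurableSet[ℱ t] A) :
    ∫⁻ ω in A, ENNReal.ofReal
        (likelihoodRatio k σ (fun i => q i ω) (fun i => ε i ω) (t + 1)) ∂μ
      = ∫⁻ ω in A, ENNReal.ofReal
        (likelihoodRatio k σ (fun i => q i ω) (fun i => ε i ω) t) ∂μ := by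
  have hA' : MeasurableSet A := ℱ.le t A hA
  have ht : 1 ≤ t + 1 := Nat.le_add_left 1 t
  rw [← lintegral_indicator hA', ← lintegral_indicator hA',
    ← lintegral_mul_gaussianRatio hσ (ℱ.le t) ((hε _ ht).mono (ℱ.le _) le_rfl) (hind _ ht)
      (hlaw _ ht) (measurable_postMean hkc hk hσ hq hε t) (measurable_postVar hkc hk hσ hq t)
      (fun ω => postVar_nonneg hk hσ _ _)
      (((measurable_likelihoodRatio hkc hk hσ hq hε t).ennreal_ofReal).indicator hA)]
  refine lintegral_congr fun ω => ?_
  by_cases hω : ω ∈ A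
  · simp only [Set.indicator_of_mem hω]
    rw [likelihoodRatio_succ hk hσ, ENNReal.ofReal_mul (by exact Real.exp_nonneg _)]
  · simp only [Set.indicator_of_notMem hω, zero_mul]

theorem lintegral_likelihoodRatio (hkc : Continuous (Function.uncurry k))
    (hk : ∀ p q, k p q = ⟪φ p, φ q⟫_ℝ) (hσ : 0 < σ)
    (hq : ∀ t, 1 ≤ t → Measurable[ℱ (t - 1)] (q t)) (hε : ∀ t, 1 ≤ t → Measurable[ℱ t] (ε t))
    (hind : ∀ t, 1 ≤ t → Indep (MeasurableSpace.comap (ε t) inferInstance) (ℱ (t - 1)) μ)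
    (hlaw : ∀ t, 1 ≤ t → μ.map (ε t) = gaussianReal 0 (Real.toNNReal (σ ^ 2))) (t : ℕ) :
    ∫⁻ ω, ENNReal.ofReal (likelihoodRatio k σ (fun i => q i ω) (fun i => ε i ω) t) ∂μ = 1 := by
  induction t with
  | zero => simp [likelihoodRatio_zero]
  | succ t ih =>
    rw [← ih]
    simpa using setLIntegral_likelihoodRatio_succ hkc hk hσ hq hε hind hlaw t MeasurableSet.univ

/-- With high probability, the energy of the noise is controlled by the information gain. -/
theorem exists_noiseEnergy_lt (hkc : Continuous (Function.uncurry k))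
    (hk : ∀ p q, k p q = ⟪φ p, φ q⟫_ℝ) (hσ : 0 < σ)
    (hq : ∀ t, 1 ≤ t → Measurable[ℱ (t - 1)] (q t)) (hε : ∀ t, 1 ≤ t → Measurable[ℱ t] (ε t))
    (hind : ∀ t, 1 ≤ t → Indep (MeasurableSpace.comap (ε t) inferInstance) (ℱ (t - 1)) μ)
    (hlaw : ∀ t, 1 ≤ t → μ.map (ε t) = gaussianReal 0 (Real.toNNReal (σ ^ 2)))
    {δ : ℝ} (hδ : 0 < δ) :
    ∃ E : Set Ω, MeasurableSet E ∧ 1 - δ ≤ μ.real E ∧ ∀ ω ∈ E, ∀ t,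
      noiseEnergy k σ (firstIter (fun i => q i ω) t) (firstIter (fun i => ε i ω) t) / (2 * σ ^ 2)
        < infoGain k σ (firstIter (fun i => q i ω) t) + Real.log (1 / δ) := by
  set M : ℕ → Ω → ℝ := fun t ω => likelihoodRatio k σ (fun i => q i ω) (fun i => ε i ω) t with hMdef
  have hM0 : 0 ≤ M := fun t ω => Real.exp_nonneg _
  have hMm : ∀ t, Measurable[ℱ t] (M t) := measurable_likelihoodRatio hkc hk hσ hq hε
  have hMm' : ∀ t, AEStronglyMeasurable (M t) μ := fun t =>
    ((hMm t).mono (ℱ.le t) le_rfl).aestronglyMeasurable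
  have hl : ∀ t, ∫⁻ ω, ENNReal.ofReal (M t ω) ∂μ = 1 :=
    lintegral_likelihoodRatio hkc hk hσ hq hε hind hlaw
  have hint : ∀ t, Integrable (M t) μ := fun t => by
    refine ⟨hMm' t, ?_⟩
    rw [hasFiniteIntegral_iff_ofReal (ae_of_all _ (hM0 t)), hl]
    exact ENNReal.one_lt_top
  have hM1 : ∀ t, ∫ ω, M t ω ∂μ = 1 := fun t => by
    rw [integral_eq_lintegral_of_nonneg_ae (ae_of_all _ (hM0 t)) (hMm' t), hl, ENNReal.toReal_one]
  have hM : Martingale M ℱ μ := by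
    refine martingale_of_setIntegral_eq_succ (fun t => (hMm t).stronglyMeasurable) hint
      fun t A hA => ?_
    rw [integral_eq_lintegral_of_nonneg_ae (ae_of_all _ (hM0 t)) (hMm' t).restrict,
      integral_eq_lintegral_of_nonneg_ae (ae_of_all _ (hM0 (t + 1))) (hMm' (t + 1)).restrict,
      setLIntegral_likelihoodRatio_succ hkc hk hσ hq hε hind hlaw t hA]
  obtain ⟨E, hE, hE1, hE2⟩ := exists_measurableSet_forall_lt hM hM0 hM1 hδ
  refine ⟨E, hE, hE1, fun ω hω t => ?_⟩
  have h := (Real.lt_log_iff_exp_lt (by positivity)).2 (hE2 ω hω t)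
  linarith

end Confidence

/-! ### From confidence widths to the regret bound -/

section Regret

variable {D H : Type*} [NormedAddCommGroup H] [InnerProductSpace ℝ H]
  {k : D → D → ℝ} {φ : D → H} {σ B δ : ℝ}

/-- The confidence bounds hold whenever the energy of the noise is controlled. -/
theorem abs_sub_postMean_le_sqrt_beta (hk : ∀ p q, k p q = ⟪φ p, φ q⟫_ℝ) (hk1 : ∀ p, k p p ≤ 1)
    (hσ : 0 < σ) {f : H} (hf : ‖f‖ ≤ B) (q : ℕ → D) (e y : ℕ → ℝ)
    (hy : ∀ t, 1 ≤ t → y t = ⟪f, φ (q t)⟫_ℝ + e t) (t : ℕ)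
    (hE : noiseEnergy k σ (firstIter q (t - 1)) (firstIter e (t - 1)) / (2 * σ ^ 2)
      < infoGain k σ (firstIter q (t - 1)) + Real.log (1 / δ)) (p : D) :
    |⟪f, φ p⟫_ℝ - postMean k σ (firstIter q (t - 1)) (firstIter y (t - 1)) p|
      ≤ √(beta k σ B δ t) * postStd k σ (firstIter q (t - 1)) p := by
  have hy' : firstIter y (t - 1)
      = fun i => ⟪f, φ (firstIter q (t - 1) i)⟫_ℝ + firstIter e (t - 1) i := by
    ext i
    exact hy _ (Nat.le_add_left 1 i)
  rw [hy', sqrt_beta_eq ((norm_nonneg f).trans hf)]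
  refine (abs_sub_postMean_le hk hσ _ p _ f).trans
    (mul_le_mul_of_nonneg_right (add_le_add hf ?_) (Real.sqrt_nonneg _))
  have hγ := infoGain_le_maxInfoGain hk hk1 hσ (firstIter q (t - 1))
  rw [div_lt_iff₀ (by positivity)] at hE
  -- The factor `max 1 σ` and the `+ 1` under the root are slack: the noise term already fits
  -- without them.
  refine le_trans ?_ (le_mul_of_one_le_left (Real.sqrt_nonneg _) (le_max_left 1 σ))
  rw [div_le_iff₀ hσ, ← Real.sqrt_sq hσ.le, ← Real.sqrt_mul' _ (sq_nonneg _), Real.sqrt_sq hσ.le]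
  refine Real.sqrt_le_sqrt ?_
  nlinarith [sq_nonneg σ]

theorem ucb_sub_lcb (q : ℕ → D) (y : ℕ → ℝ) (t : ℕ) (p : D) :
    ucb k σ B δ q y t p - lcb k σ B δ q y t p
      = 2 * (√(beta k σ B δ t) * postStd k σ (firstIter q (t - 1)) p) := by
  rw [ucb, lcb]; ring

/-- A quantity bounded by the width of each of the first `T` confidence intervals obeys the
regret bound. -/
theorem le_sqrt_of_forall_le_width [Nonempty D] (hk : ∀ p q, k p q = ⟪φ p, φ q⟫_ℝ)
    (hk1 : ∀ p, k p p ≤ 1) (hσ : 0 < σ) (hB : 0 ≤ B) (q : ℕ → D) (y : ℕ → ℝ) {T : ℕ} (hT : 1 ≤ T)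
    {r : ℝ} (hr0 : 0 ≤ r) (hr : ∀ t ∈ Finset.Icc 1 T,
      r ≤ ucb k σ B δ q y t (q t) - lcb k σ B δ q y t (q t)) :
    r ≤ √(regretConst σ * beta k σ B δ T * maxInfoGain k σ T / T) := by
  have hT0 : (0 : ℝ) < T := by exact_mod_cast hT
  have hβ : 0 ≤ beta k σ B δ T := sq_nonneg _
  refine Real.le_sqrt_of_sq_le ?_
  rw [le_div_iff₀ hT0]
  calc r ^ 2 * T = ∑ t ∈ Finset.range T, r ^ 2 := by simp [mul_comm]
    _ ≤ ∑ t ∈ Finset.range T,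
        beta k σ B δ T * (4 * postVar k σ (firstIter q t) (q (t + 1))) := by
      refine Finset.sum_le_sum fun t ht => ?_
      have ht' : t + 1 ≤ T := Finset.mem_range.1 ht
      have h := hr (t + 1) (Finset.mem_Icc.2 ⟨Nat.le_add_left 1 t, ht'⟩)
      rw [ucb_sub_lcb] at h
      have h0 := postVar_nonneg hk hσ (firstIter q t) (q (t + 1))
      -- Monotonicity replaces every earlier confidence parameter by the last one, which then leaves
      -- the sum.
      have h1 := beta_mono (B := B) (δ := δ) hk hk1 hσ hB ht'
      calc r ^ 2 ≤ (2 * (√(beta k σ B δ (t + 1)) * postStd k σ (firstIter q t) (q (t + 1)))) ^ 2 :=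
            pow_le_pow_left₀ hr0 h 2
        _ = beta k σ B δ (t + 1) * (4 * postVar k σ (firstIter q t) (q (t + 1))) := by
          rw [postStd, mul_pow, mul_pow, Real.sq_sqrt (by exact sq_nonneg _), Real.sq_sqrt h0]
          ring
        _ ≤ _ := by gcongr
    _ = beta k σ B δ T * ∑ t ∈ Finset.range T, 4 * postVar k σ (firstIter q t) (q (t + 1)) :=
      (Finset.mul_sum _ _ _).symm
    _ ≤ beta k σ B δ T * (regretConst σ * maxInfoGain k σ T) :=
      mul_le_mul_of_nonneg_left (sum_postVar_le hk hk1 hσ q T) hβ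
    _ = regretConst σ * beta k σ B δ T * maxInfoGain k σ T := by ring

end Regret

/-! ### Feature vectors in the reproducing kernel Hilbert space -/

section KernelSpace

open RKHS

variable {D H : Type*} [NormedAddCommGroup H] [InnerProductSpace ℝ H]
  [CompleteSpace H] [RKHS ℝ H D ℝ] {k : D → D → ℝ}

theorem kernel_eq_inner (hH : ∀ p q, kernel H p q 1 = k p q) (p q : D) :
    k p q = ⟪kerFun H p 1, kerFun H q 1⟫_ℝ := by
  rw [← hH, real_inner_comm, ← kernel_inner]
  simp

theorem apply_eq_inner (f : H) (p : D) : f p = ⟪f, kerFun H p 1⟫_ℝ := by simp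

/-- The elements of the reproducing kernel Hilbert space of a continuous kernel are continuous. -/
theorem continuous_of_continuous_kernel [TopologicalSpace D]
    (hkc : Continuous (Function.uncurry k))
    (hH : ∀ p q, kernel H p q 1 = k p q) (f : H) : Continuous f := by
  have hφ : Continuous fun p : D => kerFun H p (1 : ℝ) := by
    refine continuous_iff_continuousAt.2 fun p => ?_
    rw [ContinuousAt, tendsto_iff_norm_sub_tendsto_zero]
    -- The distance between feature vectors is a continuous function of kernel values that vanishes
    -- at `q = p`.
    have h : ∀ q, ‖kerFun H q (1 : ℝ) - kerFun H p 1‖ = √(k q q - 2 * k q p + k p p) := fun q => by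
      rw [kernel_eq_inner hH, kernel_eq_inner hH, kernel_eq_inner hH,
        real_inner_self_eq_norm_sq, real_inner_self_eq_norm_sq, ← norm_sub_sq_real,
        Real.sqrt_sq (norm_nonneg _)]
    simp only [h]
    have hc : Continuous fun q => √(k q q - 2 * k q p + k p p) :=
      (((hkc.comp (continuous_id.prodMk continuous_id)).sub
        (continuous_const.mul (hkc.comp (continuous_id.prodMk continuous_const)))).add
          continuous_const).sqrt
    have := hc.tendsto p
    rwa [show k p p - 2 * k p p + k p p = 0 by ring, Real.sqrt_zero] at this
  have h : (f : D → ℝ) = fun p => ⟪f, kerFun H p 1⟫_ℝ := funext (apply_eq_inner f)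
  rw [h]
  exact continuous_const.inner hφ

end KernelSpace

end VUCB

/-! ### The regret bound for the recommended input -/

theorem mainTheorem8
    {dx dz : ℕ}
    -- the domain of `x`, and the law of `Z`, whose support is the domain of `z`
    (Dx : Set (EuclideanSpace ℝ (Fin dx)))
    (P : Measure (EuclideanSpace ℝ (Fin dz))) [IsProbabilityMeasure P]
    -- the kernel, its reproducing kernel Hilbert space, and the objective function
    (k : Dx × P.support → Dx × P.support → ℝ)
    (hk_cont : Continuous (Function.uncurry k)) (hk_diag : ∀ p, k p p ≤ 1)
    {H : Type*} [NormedAddCommGroup H] [InnerProductSpace ℝ H] [CompleteSpace H]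
    [RKHS ℝ H (Dx × P.support) ℝ] (hH : ∀ p q, RKHS.kernel H p q 1 = k p q)
    (B : ℝ) (f : H) (hf : ‖f‖ ≤ B)
    (σ δ α : ℝ) (hσ : 0 < σ) (hδ : δ ∈ Set.Ioo (0 : ℝ) 1) (hα : α ∈ Set.Ioo (0 : ℝ) 1)
    -- the maximizer of the value-at-risk of the objective
    (xstar : Dx)
    (hxstar : ∀ x', VUCB.varAt (VUCB.lawOnSupport P) α f x' ≤
      VUCB.varAt (VUCB.lawOnSupport P) α f xstar)
    -- the queries `(x t, z t)` and the noise `ε t` of the iterations `t = 1, 2, …`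
    {Ω : Type*} [mΩ : MeasurableSpace Ω] (μ : Measure Ω) [IsProbabilityMeasure μ]
    (ℱ : Filtration ℕ mΩ)
    (x : ℕ → Ω → Dx) (z : ℕ → Ω → P.support) (ε y : ℕ → Ω → ℝ)
    (hx_meas : ∀ t, 1 ≤ t → Measurable[ℱ (t - 1)] (x t))
    (hz_meas : ∀ t, 1 ≤ t → Measurable[ℱ (t - 1)] (z t))
    (hε_meas : ∀ t, 1 ≤ t → Measurable[ℱ t] (ε t))
    (hε_indep : ∀ t, 1 ≤ t →
      Indep (MeasurableSpace.comap (ε t) inferInstance) (ℱ (t - 1)) μ)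
    (hε_law : ∀ t, 1 ≤ t → μ.map (ε t) = gaussianReal 0 (Real.toNNReal (σ ^ 2)))
    (hy : ∀ t, 1 ≤ t → ∀ ω, y t ω = f (x t ω, z t ω) + ε t ω)
    -- `x t` maximizes the value-at-risk of the upper bound, and `z t` is a lacing value
    (hx_max : ∀ t, 1 ≤ t → ∀ ω x',
      VUCB.varAt (VUCB.lawOnSupport P) α
          (VUCB.ucb k σ B δ (fun s => (x s ω, z s ω)) (fun s => y s ω) t) x' ≤
        VUCB.varAt (VUCB.lawOnSupport P) α
          (VUCB.ucb k σ B δ (fun s => (x s ω, z s ω)) (fun s => y s ω) t) (x t ω))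
    (hz_lacing : ∀ t, 1 ≤ t → ∀ ω,
      VUCB.IsLacingValue (VUCB.lawOnSupport P) α
        (VUCB.lcb k σ B δ (fun s => (x s ω, z s ω)) (fun s => y s ω) t)
        (VUCB.ucb k σ B δ (fun s => (x s ω, z s ω)) (fun s => y s ω) t) (x t ω) (z t ω)) :
    ∃ E : Set Ω, MeasurableSet E ∧ 1 - δ ≤ μ.real E ∧
      ∀ ω ∈ E, ∀ T : ℕ, 1 ≤ T → ∀ tstar ∈ Finset.Icc 1 T,
        (∀ t ∈ Finset.Icc 1 T,
          VUCB.varAt (VUCB.lawOnSupport P) α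
              (VUCB.lcb k σ B δ (fun s => (x s ω, z s ω)) (fun s => y s ω) t) (x t ω) ≤
            VUCB.varAt (VUCB.lawOnSupport P) α
              (VUCB.lcb k σ B δ (fun s => (x s ω, z s ω)) (fun s => y s ω) tstar)
              (x tstar ω)) →
        VUCB.regret (VUCB.lawOnSupport P) α f xstar (x tstar ω) ≤
          √(VUCB.regretConst σ * VUCB.beta k σ B δ T * VUCB.maxInfoGain k σ T / T) := by
  have hk : ∀ p q, k p q = inner ℝ (RKHS.kerFun H p (1 : ℝ)) (RKHS.kerFun H q 1) :=
    VUCB.kernel_eq_inner hH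
  have hB : 0 ≤ B := (norm_nonneg f).trans hf
  have hP : IsProbabilityMeasure (VUCB.lawOnSupport P) := VUCB.isProbabilityMeasure_lawOnSupport P
  have hfc : Continuous f := VUCB.continuous_of_continuous_kernel hk_cont hH f
  have hmono : ∀ {g h : Dx × P.support → ℝ}, Continuous g → (∀ p, g p ≤ h p) → ∀ x',
      VUCB.varAt (VUCB.lawOnSupport P) α g x' ≤ VUCB.varAt (VUCB.lawOnSupport P) α h x' :=
    fun hg hgh x' => VUCB.valueAtRisk_mono hα (hg.comp (Continuous.prodMk_right x')).measurable
      fun _ => hgh _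
  obtain ⟨E, hE, hE1, hE2⟩ := VUCB.exists_noiseEnergy_lt (q := fun t ω => (x t ω, z t ω)) (ε := ε)
    hk_cont hk hσ (fun t ht => (hx_meas t ht).prodMk (hz_meas t ht)) hε_meas hε_indep hε_law hδ.1
  refine ⟨E, hE, hE1, fun ω hω T hT tstar htstar hmax => ?_⟩
  set q : ℕ → Dx × P.support := fun s => (x s ω, z s ω) with hq
  set l := VUCB.lcb k σ B δ q (fun s => y s ω) with hl
  set u := VUCB.ucb k σ B δ q (fun s => y s ω) with hu
  have hD : Nonempty (Dx × P.support) := ⟨q 0⟩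
  have hconf : ∀ t p, |f p - VUCB.postMean k σ (VUCB.firstIter q (t - 1))
      (VUCB.firstIter (fun s => y s ω) (t - 1)) p|
      ≤ √(VUCB.beta k σ B δ t) * VUCB.postStd k σ (VUCB.firstIter q (t - 1)) p := fun t p => by
    rw [VUCB.apply_eq_inner f p]
    refine VUCB.abs_sub_postMean_le_sqrt_beta hk hk_diag hσ hf q (fun s => ε s ω) _
      (fun s hs => ?_) t (hE2 ω hω (t - 1)) p
    rw [← VUCB.apply_eq_inner]
    exact hy s hs ω
  have hlf : ∀ t p, l t p ≤ f p := fun t p => by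
    have := (abs_le.1 (hconf t p)).1
    rw [hl, VUCB.lcb]
    linarith
  have hfu : ∀ t p, f p ≤ u t p := fun t p => by
    have := (abs_le.1 (hconf t p)).2
    rw [hu, VUCB.ucb]
    linarith
  have hlc : ∀ t, Continuous (l t) := VUCB.continuous_lcb hk_cont hk hσ B δ q _
  refine VUCB.le_sqrt_of_forall_le_width hk hk_diag hσ hB q (fun s => y s ω) hT
    (sub_nonneg.2 (hxstar _)) fun t ht => ?_
  have ht1 := (Finset.mem_Icc.1 ht).1
  obtain ⟨hz1, -, hz2⟩ := hz_lacing t ht1 ω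
  -- The upper chain runs from `f` at `xstar` through `u t` to the lacing point; the lower chain
  -- runs from the lacing point through `l t` and `l tstar` to `f` at the recommended input.
  exact sub_le_sub
    ((hmono hfc (hfu t) xstar).trans ((hx_max t ht1 ω xstar).trans hz2))
    (hz1.trans ((hmax t ht).trans (hmono (hlc tstar) (hlf tstar) _)))
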